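/- All rings are commutative with identity and all modules are unitary. Let $R$ be a ring with nilradical $\mathrm{Nil}(R)$, and call an ideal $I$ of $R$ \emph{nonnil} if $I\not\subseteq \mathrm{Nil}(R)$. Call $R$ a \emph{ZN-ring} if $\mathrm{Z}(R)=\mathrm{Nil}(R)$, where $\mathrm{Z}(R)=\{a\in R : ab=0 \text{ for some } 0\neq b\in R\}$ is the set of zero-divisors of $R$. An $R$-module $T$ is \emph{$\phi$-torsion} if every $x\in T$ satisfies $Ix=0$ for some nonnil ideal $I$ of $R$. An $R$-module $M$ is \emph{$\phi$-flat} if $\mathrm{Tor}_1^R(T,M)=0$ for every $\phi$-torsion $R$-module $T$, and \emph{strongly $\phi$-flat} if $\mathrm{Tor}_n^R(T,M)=0$ for every $\phi$-torsion $R$-module $T$ and every $n\geq 1$. It is \emph{nonnil-injective} if $\mathrm{Ext}^1_R(T,M)=0$ for every $\phi$-torsion $R$-module $T$, and \emph{strongly nonnil-injective} if $\mathrm{Ext}^n_R(T,M)=0$ for every $\phi$-torsion $R$-module $T$ and every $n\geq 1$. \textbf{Theorem.} Let $R$ be a ZN-ring. Then: (1) an $R$-module $M$ is $\phi$-flat if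 and only if it is strongly $\phi$-flat; (2) an $R$-module $M$ is nonnil-injective if and only if it is strongly nonnil-injective. -/

import Mathlib

open CategoryTheory

universe u

/-- The set of zero-divisors of `R`: the elements `a` with `a * b = 0` for some `b ≠ 0`. -/
def zeroDivisors (R : Type u) [CommRing R] : Set R :=
  {a | ∃ b : R, b ≠ 0 ∧ a * b = 0}

/-- A ZN-ring: the zero-divisors are exactly the nilpotent elements. -/
def IsZNRing (R : Type u) [CommRing R] : Prop :=
  zeroDivisors R = (nilradical R : Set R)

/-- A nonnil ideal: an ideal not contained in the nilradical. -/
def IsNonnilIdeal {R : Type u} [CommRing R] (I : Ideal R) : Prop :=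
  ¬ I ≤ nilradical R

/-- `φ-tor(M)`: the elements of `M` annihilated by some nonnil ideal. -/
def phiTor (R : Type u) [CommRing R] (M : Type u) [AddCommGroup M] [Module R M] : Set M :=
  {x | ∃ I : Ideal R, IsNonnilIdeal I ∧ ∀ r ∈ I, r • x = 0}

/-- `M` is `φ`-torsion: `φ-tor(M) = M`. -/
def IsPhiTorsion (R : Type u) [CommRing R] (M : Type u) [AddCommGroup M] [Module R M] : Prop :=
  phiTor R M = Set.univ

/-- `Tor_n^R(T, M) = 0`. -/
def TorVanishes (R : Type u) [CommRing R] (n : ℕ) (T : Type u) [AddCommGroup T] [Module R T]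
    (M : Type u) [AddCommGroup M] [Module R M] : Prop :=
  Limits.IsZero (((Tor (ModuleCat.{u} R) n).obj (ModuleCat.of R T)).obj (ModuleCat.of R M))

/-- `Ext^n_R(T, M) = 0`. -/
def ExtVanishes (R : Type u) [CommRing R] (n : ℕ) (T : Type u) [AddCommGroup T] [Module R T]
    (M : Type u) [AddCommGroup M] [Module R M] : Prop :=
  Subsingleton (Abelian.Ext (ModuleCat.of R T) (ModuleCat.of R M) n)

/-- `M` is `φ`-flat: `Tor_1^R(T, M) = 0` for every `φ`-torsion module `T`. -/
def IsPhiFlat (R : Type u) [CommRing R] (M : Type u) [AddCommGroup M] [Module R M] : Prop :=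
  ∀ (T : Type u) [AddCommGroup T] [Module R T], IsPhiTorsion R T → TorVanishes R 1 T M

/-- `M` is strongly `φ`-flat: `Tor_n^R(T, M) = 0` for every `φ`-torsion `T` and every `n ≥ 1`. -/
def IsStronglyPhiFlat (R : Type u) [CommRing R] (M : Type u) [AddCommGroup M] [Module R M] :
    Prop :=
  ∀ (T : Type u) [AddCommGroup T] [Module R T], IsPhiTorsion R T →
    ∀ n : ℕ, 1 ≤ n → TorVanishes R n T M

/-- `M` is nonnil-injective: `Ext^1_R(T, M) = 0` for every `φ`-torsion module `T`. -/
def IsNonnilInjective (R : Type u) [CommRing R] (M : Type u) [AddCommGroup M] [Module R M] :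
    Prop :=
  ∀ (T : Type u) [AddCommGroup T] [Module R T], IsPhiTorsion R T → ExtVanishes R 1 T M

/-- `M` is strongly nonnil-injective: `Ext^n_R(T, M) = 0` for every `φ`-torsion `T` and every
`n ≥ 1`. -/
def IsStronglyNonnilInjective (R : Type u) [CommRing R] (M : Type u) [AddCommGroup M]
    [Module R M] : Prop :=
  ∀ (T : Type u) [AddCommGroup T] [Module R T], IsPhiTorsion R T →
    ∀ n : ℕ, 1 ≤ n → ExtVanishes R n T M

/-! Over a ZN-ring, non-nilpotent means regular, so `φ`-torsion is ordinary torsion. If a regular `s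
x` kills each `x` in `T`, then `T` is a quotient of `F = ⊕ R/(s x)`, which has a free resolution of
length one; the kernel `K` lies in `F`, hence is again torsion (`exists_shortExact_of_isTorsion`).
Since Tor and Ext of `F` vanish in degrees at least two, vanishing in degree `n + 1` for `T` follows
from vanishing in degree `n ≥ 1` for `K`, and induction over all torsion modules finishes. -/

theorem exists_ne_zero_mul_eq_zero_iff_notMem_nonZeroDivisors {R : Type u} [CommRing R] (a : R) :
    (∃ b : R, b ≠ 0 ∧ a * b = 0) ↔ a ∉ nonZeroDivisors R := by
  rw [mem_nonZeroDivisors_iff_right]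
  push Not
  exact exists_congr fun b => by rw [mul_comm a b, and_comm]

/-- Over a ZN-ring the nilpotent elements are exactly those that are not regular. -/
theorem IsZNRing.mem_nilradical_iff {R : Type u} [CommRing R] (hR : IsZNRing R) (a : R) :
    a ∈ nilradical R ↔ a ∉ nonZeroDivisors R := by
  rw [← exists_ne_zero_mul_eq_zero_iff_notMem_nonZeroDivisors]
  exact (Set.ext_iff.mp hR a).symm

/-- Over a ZN-ring the `φ`-torsion modules are the torsion modules in the usual sense. -/
theorem IsZNRing.isPhiTorsion_iff_isTorsion {R : Type u} [CommRing R] (hR : IsZNRing R)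
    (T : Type u) [AddCommGroup T] [Module R T] : IsPhiTorsion R T ↔ Module.IsTorsion R T := by
  constructor
  · intro h x
    obtain ⟨I, hI, hIx⟩ : x ∈ phiTor R T := h ▸ Set.mem_univ x
    obtain ⟨a, haI, ha⟩ := SetLike.not_le_iff_exists.mp hI
    rw [hR.mem_nilradical_iff, not_not] at ha
    exact ⟨⟨a, ha⟩, hIx a haI⟩
  · intro h
    refine Set.eq_univ_of_forall fun x => ?_
    obtain ⟨a, ha⟩ := @h x
    refine ⟨Ideal.span {(a : R)}, fun hle => ?_, fun r hr => ?_⟩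
    · exact (hR.mem_nilradical_iff a).mp (hle (Ideal.mem_span_singleton_self _)) a.2
    · obtain ⟨c, rfl⟩ := Ideal.mem_span_singleton'.mp hr
      rw [mul_smul, show (a : R) • x = 0 from ha, smul_zero]

section Diagonal

variable {R ι : Type*} [CommRing R]

/-- The diagonal endomorphism of a free module with given diagonal entries. -/
noncomputable def Finsupp.diagonal (s : ι → R) : (ι →₀ R) →ₗ[R] (ι →₀ R) :=
  Finsupp.linearCombination R fun i => Finsupp.single i (s i)

theorem Finsupp.diagonal_apply (s : ι → R) (f : ι →₀ R) (i : ι) :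
    Finsupp.diagonal s f i = f i * s i := by
  classical
  induction f using Finsupp.induction_linear with
  | zero => simp
  | add f g hf hg => rw [map_add, Finsupp.add_apply, hf, hg, Finsupp.add_apply, add_mul]
  | single j r =>
    by_cases h : j = i
    · subst h; simp [Finsupp.diagonal]
    · simp [Finsupp.diagonal, h]

theorem Finsupp.diagonal_single (s : ι → R) (i : ι) (r : R) :
    Finsupp.diagonal s (Finsupp.single i r) = Finsupp.single i (r * s i) := by
  simp [Finsupp.diagonal]

theorem Finsupp.diagonal_injective {s : ι → R} (hs : ∀ i, s i ∈ nonZeroDivisors R) :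
    Function.Injective (Finsupp.diagonal s) := by
  rw [injective_iff_map_eq_zero]
  intro f hf
  ext i
  have h := DFunLike.congr_fun hf i
  rw [Finsupp.diagonal_apply] at h
  exact mul_right_mem_nonZeroDivisors_eq_zero_iff (hs i) |>.mp h

/-- Torsion elements form a submodule, so only generators matter, and `s i` kills the class of the
`i`-th one. -/
theorem Finsupp.isTorsion_quotient_range_diagonal {s : ι → R}
    (hs : ∀ i, s i ∈ nonZeroDivisors R) :
    Module.IsTorsion R ((ι →₀ R) ⧸ LinearMap.range (Finsupp.diagonal s)) := by
  intro x
  obtain ⟨f, rfl⟩ := (LinearMap.range (Finsupp.diagonal s)).mkQ_surjective x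
  rw [← Submodule.mem_torsion_iff]
  induction f using Finsupp.induction_linear with
  | zero => rw [map_zero]; exact zero_mem _
  | add f g hf hg => rw [map_add]; exact add_mem hf hg
  | single i r =>
    refine (Submodule.mem_torsion_iff _).mpr ⟨⟨s i, hs i⟩, ?_⟩
    change s i • (LinearMap.range (Finsupp.diagonal s)).mkQ (Finsupp.single i r) = 0
    rw [← map_smul, Submodule.mkQ_apply, Submodule.Quotient.mk_eq_zero]
    exact ⟨Finsupp.single i r, by
      rw [Finsupp.diagonal_single, Finsupp.smul_single, smul_eq_mul, mul_comm]⟩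

end Diagonal

/-- A torsion module is a quotient, with torsion kernel, of a module having a free resolution of
length one. -/
theorem exists_shortExact_of_isTorsion {R : Type u} [CommRing R] (T : ModuleCat.{u} R)
    (hT : Module.IsTorsion R T) :
    ∃ (S D : ShortComplex (ModuleCat.{u} R)), S.ShortExact ∧ D.ShortExact ∧ S.X₃ = T ∧
      Module.IsTorsion R S.X₁ ∧ D.X₃ = S.X₂ ∧ Module.Free R D.X₁ ∧ Module.Free R D.X₂ := by
  have hT' : ∀ x : T, ∃ a : nonZeroDivisors R, a • x = 0 := fun x => @hT x
  choose s hs using hT'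
  -- The cokernel of `d` is the direct sum of the `R/(s x)`.
  let d : (T →₀ R) →ₗ[R] (T →₀ R) := Finsupp.diagonal fun x => (s x : R)
  have hd : ∀ x : T, (s x : R) ∈ nonZeroDivisors R := fun x => (s x).2
  have hle : LinearMap.range d ≤ LinearMap.ker (Finsupp.linearCombination R (id : T → T)) := by
    rintro _ ⟨f, rfl⟩
    rw [LinearMap.mem_ker, ← LinearMap.comp_apply]
    suffices h : (Finsupp.linearCombination R (id : T → T)).comp d = 0 by rw [h]; rfl
    ext x
    simp only [d, LinearMap.comp_apply, Finsupp.lsingle_apply, Finsupp.diagonal_single, one_mul,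
      Finsupp.linearCombination_single, id_eq, LinearMap.zero_apply]
    exact hs x
  let p := (LinearMap.range d).liftQ _ hle
  have hp : Function.Surjective p := fun x =>
    ⟨Submodule.Quotient.mk (Finsupp.single x 1), by simp [p]⟩
  refine ⟨p.shortComplexKer, .mk (ModuleCat.ofHom d) (ModuleCat.ofHom (LinearMap.range d).mkQ)
    (by ext1; exact LinearMap.range_mkQ_comp d),
    LinearMap.shortExact_shortComplexKer hp, ?_, rfl, ?_, rfl,
    Module.Free.finsupp R R T, Module.Free.finsupp R R T⟩
  · refine @ShortComplex.ShortExact.mk _ _ _ _ ?_ ?_ ?_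
    · exact (ShortComplex.ShortExact.moduleCat_exact_iff_function_exact _).mpr
        (LinearMap.exact_map_mkQ_range d)
    · exact (ModuleCat.mono_iff_injective _).mpr (Finsupp.diagonal_injective hd)
    · exact (ModuleCat.epi_iff_surjective _).mpr (Submodule.mkQ_surjective _)
  · intro x
    obtain ⟨a, ha⟩ := @Finsupp.isTorsion_quotient_range_diagonal _ _ _ _ hd x.1
    exact ⟨a, Subtype.ext ha⟩

/-- Dimension shifting for `Ext` in the first variable. -/
theorem subsingleton_ext_succ_of_shortExact {C : Type*} [Category* C] [Abelian C]
    [HasExt.{u} C] {S : ShortComplex C} (hS : S.ShortExact) (M : C) (n : ℕ)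
    [Subsingleton (Abelian.Ext S.X₁ M n)] [Subsingleton (Abelian.Ext S.X₂ M (n + 1))] :
    Subsingleton (Abelian.Ext S.X₃ M (n + 1)) := by
  refine subsingleton_of_forall_eq 0 fun x => ?_
  obtain ⟨y, rfl⟩ := Abelian.Ext.contravariant_sequence_exact₃ hS M x (Subsingleton.elim _ _)
    (add_comm 1 n)
  rw [Subsingleton.elim y 0, Abelian.Ext.comp_zero]

section Tor

variable {R : Type u} [CommRing R]

/-- `Tor` vanishes in positive degrees when its first argument is flat. -/
theorem isZero_Tor_succ_of_flat (X M : ModuleCat.{u} R) [Module.Flat R X] (n : ℕ) :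
    Limits.IsZero (((Tor (ModuleCat.{u} R) (n + 1)).obj X).obj M) := by
  -- Tor is computed by resolving the second argument, so flatness of `X` keeps the resolution
  -- exact.
  let P := projectiveResolution M
  refine Limits.IsZero.of_iso ?_
    (P.isoLeftDerivedObj ((MonoidalCategory.tensoringLeft (ModuleCat.{u} R)).obj X) (n + 1))
  refine HomologicalComplex.ExactAt.isZero_homology ?_
  rw [HomologicalComplex.exactAt_iff' _ (n + 2) (n + 1) n (by simp only [ChainComplex.prev]; rfl)
    (by simp)]
  have h := Module.Flat.lTensor_shortComplex_exact X _ (P.exact_succ n)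
  exact h

/-- Dimension shifting for `Tor` in the first variable. -/
theorem isZero_Tor_succ_of_shortExact {S : ShortComplex (ModuleCat.{u} R)} (hS : S.ShortExact)
    (M : ModuleCat.{u} R) (n : ℕ)
    (h₁ : Limits.IsZero (((Tor (ModuleCat.{u} R) n).obj S.X₁).obj M))
    (h₂ : Limits.IsZero (((Tor (ModuleCat.{u} R) (n + 1)).obj S.X₂).obj M)) :
    Limits.IsZero (((Tor (ModuleCat.{u} R) (n + 1)).obj S.X₃).obj M) := by
  let P := projectiveResolution M
  let t := MonoidalCategory.tensoringLeft (ModuleCat.{u} R)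
  let e (X : ModuleCat.{u} R) (k : ℕ) := P.isoLeftDerivedObj (t.obj X) k
  let K : ShortComplex (ChainComplex (ModuleCat.{u} R) ℕ) :=
    .mk ((NatTrans.mapHomologicalComplex (t.map S.f) _).app P.complex)
      ((NatTrans.mapHomologicalComplex (t.map S.g) _).app P.complex) (by
        ext1 i
        change (t.map S.f).app _ ≫ (t.map S.g).app _ = 0
        rw [← NatTrans.comp_app, ← t.map_comp, S.zero]
        exact (MonoidalCategory.tensorRight (P.complex.X i)).map_zero _ _)
  have hK : K.ShortExact := by
    refine HomologicalComplex.shortExact_of_degreewise_shortExact K fun i => ?_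
    -- Projective terms are flat, so tensoring `S` with them stays exact.
    have : Module.Projective R (P.complex.X i) := inferInstance
    exact hS.map_of_exact (MonoidalCategory.tensorRight (P.complex.X i))
  refine Limits.IsZero.of_iso ?_ (e S.X₃ (n + 1))
  exact (hK.homology_exact₃ (n + 1) n (by simp)).isZero_of_both_zeros
    ((h₂.of_iso (e S.X₂ (n + 1)).symm).eq_of_src _ _)
    ((h₁.of_iso (e S.X₁ n).symm).eq_of_tgt _ _)

end Tor

theorem mainTheorem1 (R : Type u) [CommRing R] (hR : IsZNRing R) :
    (∀ (M : Type u) [AddCommGroup M] [Module R M],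
      IsPhiFlat R M ↔ IsStronglyPhiFlat R M) ∧
    (∀ (M : Type u) [AddCommGroup M] [Module R M],
      IsNonnilInjective R M ↔ IsStronglyNonnilInjective R M) := by
  refine ⟨fun M _ _ => ⟨fun h T _ _ hT n hn => ?_, fun h T _ _ hT => h T hT 1 le_rfl⟩,
    fun M _ _ => ⟨fun h T _ _ hT n hn => ?_, fun h T _ _ hT => h T hT 1 le_rfl⟩⟩
  · induction n, hn using Nat.le_induction generalizing T with
    | base => exact h T hT
    | succ n hn ih =>
      obtain ⟨S, D, hS, hD, hST, hS₁, hDS, _, _⟩ := exists_shortExact_of_isTorsion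
        (ModuleCat.of R T) ((hR.isPhiTorsion_iff_isTorsion T).mp hT)
      -- The shift along `D` lands in degree `n`, which must be positive for Tor of the free `D.X₁`
      -- to vanish.
      obtain ⟨n, rfl⟩ := Nat.exists_eq_add_of_le' hn
      have hF := isZero_Tor_succ_of_shortExact hD (ModuleCat.of R M) (n + 1)
        (isZero_Tor_succ_of_flat _ _ _) (isZero_Tor_succ_of_flat _ _ _)
      rw [hDS] at hF
      have hK := ih S.X₁ _ _ ((hR.isPhiTorsion_iff_isTorsion S.X₁).mpr hS₁)
      have hE := isZero_Tor_succ_of_shortExact hS (ModuleCat.of R M) (n + 1) hK hF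
      rwa [hST] at hE
  · induction n, hn using Nat.le_induction generalizing T with
    | base => exact h T hT
    | succ n hn ih =>
      obtain ⟨S, D, hS, hD, hST, hS₁, hDS, _, _⟩ := exists_shortExact_of_isTorsion
        (ModuleCat.of R T) ((hR.isPhiTorsion_iff_isTorsion T).mp hT)
      -- Projective dimension at most one kills Ext in degree `n + 1 ≥ 2`.
      have hF : HasProjectiveDimensionLT D.X₃ 2 :=
        hD.hasProjectiveDimensionLT_X₃ 1 inferInstance inferInstance
      rw [hDS] at hF
      have hF' : Subsingleton (Abelian.Ext S.X₂ (ModuleCat.of R M) (n + 1)) :=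
        HasProjectiveDimensionLT.subsingleton S.X₂ 2 (n + 1) (by omega) _
      have hK : Subsingleton (Abelian.Ext S.X₁ (ModuleCat.of R M) n) :=
        ih S.X₁ _ _ ((hR.isPhiTorsion_iff_isTorsion S.X₁).mpr hS₁)
      have hE := subsingleton_ext_succ_of_shortExact hS (ModuleCat.of R M) n
      rwa [hST] at hE
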